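/- Let $k$ be a field, and let $H$ and $K$ be cocommutative Hopf algebras over $k$ (Sweedler notation $\Delta(x)=x_1\otimes x_2$). Let $\rightharpoonup:H\otimes K\to K$ make $K$ a left $H$-module bialgebra, i.e. it is a left module structure, a homomorphism of coalgebras, and satisfies $x\rightharpoonup 1=\varepsilon(x)1$ and $x\rightharpoonup(ab)=(x_1\rightharpoonup a)(x_2\rightharpoonup b)$. Let $T:K\to H$ be a relative Rota--Baxter operator, i.e. a coalgebra homomorphism with $$T(a)T(b)=T\big(a_1(T(a_2)\rightharpoonup b)\big)\qquad(a,b\in K).$$ Put $K_T=(K,*_T,1,\Delta,\varepsilon,S_T)$ with $a*_Tb=a_1(T(a_2)\rightharpoonup b)$ and $S_T(a)=S_H(T(a_1))\rightharpoonup S_K(a_2)$, and define $\leftharpoonup:H\otimes K\to H$ by $$x\leftharpoonup a=S_H\big(T(x_1\rightharpoonup a_1)\big)\,x_2\,T(a_2).$$ Then: 1. $K_T$ is a cocommutative Hopf algebra, and $H$ is a right $K_T$-module coalgebra via $\leftharpoonup$ (a right module structure which is a homomorphism of coalgebras $H\otimes K_T\to H$). 2. $(H,K_T,\rightharpoonup,\leftharpoonup)$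 is a matched pair of Hopf algebras. That is, $K_T$ is a left $H$-module coalgebra via $\rightharpoonup$, $H$ is a right $K_T$-module coalgebra via $\leftharpoonup$, and for all $x,y\in H$, $a,b\in K$: $x\rightharpoonup(a*_Tb)=(x_1\rightharpoonup a_1)*_T((x_2\leftharpoonup a_2)\rightharpoonup b)$; $x\rightharpoonup 1=\varepsilon(x)1$; $(xy)\leftharpoonup a=(x\leftharpoonup(y_1\rightharpoonup a_1))(y_2\leftharpoonup a_2)$; $1\leftharpoonup a=\varepsilon(a)1$; and $(x_1\leftharpoonup a_1)\otimes(x_2\rightharpoonup a_2)=(x_2\leftharpoonup a_2)\otimes(x_1\rightharpoonup a_1)$. 3. The double crossproduct $K_T\bowtie H$ is a Hopf algebra. Here $K_T\bowtie H$ is the space $K\otimes H$ with unit $1\otimes 1$, product $(a\otimes x)(b\otimes y)=a*_T(x_1\rightharpoonup b_1)\otimes(x_2\leftharpoonup b_2)y$, the tensor product coproduct and counit, and antipode $S(a\otimes x)=(S_H(x_2)\rightharpoonup S_T(a_2))\otimes(S_H(x_1)\leftharpoonup S_T(a_1))$. The smash product $K\rtimes H$ is a Hopf algebra as well; it is the space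 $K\otimes H$ with unit $1\otimes 1$, product $(a\# x)(b\# y)=a(x_1\rightharpoonup b)\# x_2y$, the tensor product coproduct and counit, and antipode $S(a\# x)=(S_H(x_1)\rightharpoonup S_K(a))\# S_H(x_2)$. The linear map $$\Phi_T:K_T\bowtie H\to K\rtimes H,\qquad \Phi_T(a\otimes x)=a_1\otimes T(a_2)x,$$ is an isomorphism of Hopf algebras. -/

import Mathlib

open scoped TensorProduct

noncomputable section

namespace RRB

open TensorProduct

/-- The structure maps of a would-be Hopf algebra on a fixed `k`-module `V`
(no axioms; see `HopfOps.IsHopfAlgebra`). It is used to put several Hopf algebra structures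
on the same vector space. -/
structure HopfOps (k : Type*) [Field k] (V : Type*) [AddCommGroup V] [Module k V] where
  mul : V →ₗ[k] V →ₗ[k] V
  one : V
  comul : V →ₗ[k] V ⊗[k] V
  counit : V →ₗ[k] k
  antipode : V →ₗ[k] V

namespace HopfOps

/-- The structure maps of a Hopf algebra in Mathlib's sense. -/
def of (k : Type*) [Field k] (A : Type*) [Ring A] [HopfAlgebra k A] : HopfOps k A where
  mul := LinearMap.mul k A
  one := 1
  comul := Coalgebra.comul
  counit := Coalgebra.counit
  antipode := HopfAlgebra.antipode k

/-- The linear equivalence `e` identifies the operations `s` on `V` with the operations of the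
(Mathlib) Hopf algebra `A`. -/
structure IsRealizedBy {k : Type*} [Field k] {V : Type*} [AddCommGroup V] [Module k V]
    (s : HopfOps k V) (A : Type*) [Ring A] [HopfAlgebra k A] (e : V ≃ₗ[k] A) : Prop where
  map_mul : ∀ x y, e (s.mul x y) = e x * e y
  map_one : e s.one = 1
  map_comul : ∀ x, TensorProduct.map e.toLinearMap e.toLinearMap (s.comul x) =
    Coalgebra.comul (R := k) (e x)
  map_counit : ∀ x, s.counit x = Coalgebra.counit (R := k) (e x)
  map_antipode : ∀ x, e (s.antipode x) = HopfAlgebra.antipode k (e x)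

/-- The operations `s` make `V` a Hopf algebra: they are those of a Hopf algebra in Mathlib's
sense, living on a copy of `V`. -/
def IsHopfAlgebra.{u, v} {k : Type u} [Field k] {V : Type v} [AddCommGroup V] [Module k V]
    (s : HopfOps k V) : Prop :=
  ∃ (A : Type v) (_ : Ring A) (_ : HopfAlgebra k A) (e : V ≃ₗ[k] A), s.IsRealizedBy A e

/-- Cocommutativity. -/
def IsCocommutative {k : Type*} [Field k] {V : Type*} [AddCommGroup V] [Module k V]
    (s : HopfOps k V) : Prop :=
  ∀ x, TensorProduct.comm k V V (s.comul x) = s.comul x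

/-- The tensor product comultiplication `v ⊗ w ↦ (v₁ ⊗ w₁) ⊗ (v₂ ⊗ w₂)`. -/
def tensorComul {k : Type*} [Field k] {V W : Type*} [AddCommGroup V] [Module k V]
    [AddCommGroup W] [Module k W] (s : HopfOps k V) (t : HopfOps k W) :
    V ⊗[k] W →ₗ[k] (V ⊗[k] W) ⊗[k] (V ⊗[k] W) :=
  (TensorProduct.tensorTensorTensorComm k V V W W).toLinearMap ∘ₗ
    TensorProduct.map s.comul t.comul

/-- The tensor product counit `v ⊗ w ↦ ε(v) ε(w)`. -/
def tensorCounit {k : Type*} [Field k] {V W : Type*} [AddCommGroup V] [Module k V]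
    [AddCommGroup W] [Module k W] (s : HopfOps k V) (t : HopfOps k W) : V ⊗[k] W →ₗ[k] k :=
  LinearMap.mul' k k ∘ₗ TensorProduct.map s.counit t.counit

/-- `f` is an isomorphism of Hopf algebras: a linear bijection compatible with all the
structure maps. -/
structure IsHopfIso {k : Type*} [Field k] {V W : Type*} [AddCommGroup V] [Module k V]
    [AddCommGroup W] [Module k W] (s : HopfOps k V) (t : HopfOps k W) (f : V →ₗ[k] W) :
    Prop where
  bijective : Function.Bijective f
  map_mul : ∀ x y, f (s.mul x y) = t.mul (f x) (f y)
  map_one : f s.one = t.one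
  map_comul : ∀ x, TensorProduct.map f f (s.comul x) = t.comul (f x)
  map_counit : ∀ x, t.counit (f x) = s.counit x
  map_antipode : ∀ x, f (s.antipode x) = t.antipode (f x)

/-- A copy of `V`, to carry the operations `s` as instances. -/
def Carrier.{u, v} {k : Type u} [Field k] {V : Type v} [AddCommGroup V] [Module k V]
    (_ : HopfOps k V) : Type v := V

instance {k : Type*} [Field k] {V : Type*} [AddCommGroup V] [Module k V] (s : HopfOps k V) :
    AddCommGroup s.Carrier := inferInstanceAs (AddCommGroup V)

instance {k : Type*} [Field k] {V : Type*} [AddCommGroup V] [Module k V] (s : HopfOps k V) :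
    Module k s.Carrier := inferInstanceAs (Module k V)

/-- The operations of a Hopf algebra satisfy `IsHopfAlgebra`. -/
theorem isHopfAlgebra_of (k : Type*) [Field k] (A : Type*) [Ring A] [HopfAlgebra k A] :
    (of k A).IsHopfAlgebra :=
  ⟨A, inferInstance, inferInstance, LinearEquiv.refl k A,
    { map_mul := fun _ _ => rfl
      map_one := rfl
      map_comul := fun x => by simp [of]
      map_counit := fun _ => rfl
      map_antipode := fun _ => rfl }⟩

/-- The usual axioms of a Hopf algebra, spelled out, imply `IsHopfAlgebra`. -/
theorem isHopfAlgebra_of_axioms {k : Type*} [Field k] {V : Type*} [AddCommGroup V]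
    [Module k V] (s : HopfOps k V)
    (mul_assoc : ∀ x y z, s.mul (s.mul x y) z = s.mul x (s.mul y z))
    (one_mul : ∀ x, s.mul s.one x = x)
    (mul_one : ∀ x, s.mul x s.one = x)
    (coassoc : ∀ x, TensorProduct.assoc k V V V (s.comul.rTensor V (s.comul x)) =
      s.comul.lTensor V (s.comul x))
    (rTensor_counit : ∀ x, s.counit.rTensor V (s.comul x) = 1 ⊗ₜ x)
    (lTensor_counit : ∀ x, s.counit.lTensor V (s.comul x) = x ⊗ₜ 1)
    (counit_one : s.counit s.one = 1)
    (counit_mul : ∀ x y, s.counit (s.mul x y) = s.counit x * s.counit y)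
    (comul_one : s.comul s.one = s.one ⊗ₜ s.one)
    (comul_mul : ∀ x y, s.comul (s.mul x y) =
      TensorProduct.map₂ s.mul s.mul (s.comul x) (s.comul y))
    (antipode_left : ∀ x, TensorProduct.lift s.mul (s.antipode.rTensor V (s.comul x)) =
      s.counit x • s.one)
    (antipode_right : ∀ x, TensorProduct.lift s.mul (s.antipode.lTensor V (s.comul x)) =
      s.counit x • s.one) :
    s.IsHopfAlgebra := by
  let ring : Ring s.Carrier :=
    { (inferInstance : AddCommGroup s.Carrier) with
      mul := fun x y => s.mul x y
      one := s.one
      mul_assoc := mul_assoc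
      one_mul := one_mul
      mul_one := mul_one
      left_distrib := fun x y z => map_add (s.mul x) y z
      right_distrib := fun x y z => LinearMap.map_add₂ s.mul x y z
      zero_mul := fun x => LinearMap.map_zero₂ s.mul x
      mul_zero := fun x => map_zero (s.mul x) }
  let alg : Algebra k s.Carrier := Algebra.ofModule
    (fun r x y => LinearMap.map_smul₂ s.mul r x y) (fun r x y => map_smul (s.mul x) r y)
  let coalg : Coalgebra k s.Carrier :=
    { comul := s.comul
      counit := s.counit
      coassoc := LinearMap.ext coassoc
      rTensor_counit_comp_comul := LinearMap.ext rTensor_counit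
      lTensor_counit_comp_comul := LinearMap.ext lTensor_counit }
  have hmul₂ : ∀ u v : s.Carrier ⊗[k] s.Carrier,
      u * v = TensorProduct.map₂ s.mul s.mul u v := by
    have h : Algebra.TensorProduct.mul (R := k) (A := s.Carrier) (B := s.Carrier) =
        TensorProduct.map₂ s.mul s.mul := by
      apply TensorProduct.ext'
      intro a b
      apply TensorProduct.ext'
      intro c d
      exact (Algebra.TensorProduct.mul_apply (A := s.Carrier) (B := s.Carrier) a c b d).trans
        ((LinearMap.congr_fun (TensorProduct.map₂_apply_tmul s.mul s.mul a b) (c ⊗ₜ d)).trans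
          (TensorProduct.map_tmul (s.mul a) (s.mul b) c d)).symm
    exact fun u v => congrArg (fun f => f u v) h
  let bialg : Bialgebra k s.Carrier := Bialgebra.mk' k s.Carrier counit_one
    (fun {x y} => counit_mul x y) comul_one
    (fun {x y} => (comul_mul x y).trans (hmul₂ (s.comul x) (s.comul y)).symm)
  have hmul : LinearMap.mul' k s.Carrier = TensorProduct.lift s.mul := by
    apply TensorProduct.ext'
    intro x y
    rfl
  let hopf : HopfAlgebra k s.Carrier :=
    { bialg with
      antipode := s.antipode
      mul_antipode_rTensor_comul := by
        rw [hmul]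
        exact LinearMap.ext fun x => (antipode_left x).trans
          (Algebra.algebraMap_eq_smul_one (A := s.Carrier) _).symm
      mul_antipode_lTensor_comul := by
        rw [hmul]
        exact LinearMap.ext fun x => (antipode_right x).trans
          (Algebra.algebraMap_eq_smul_one (A := s.Carrier) _).symm }
  refine ⟨s.Carrier, ring, hopf, LinearEquiv.refl k V, ?_, ?_, ?_, ?_, ?_⟩
  · intro x y; rfl
  · rfl
  · intro x
    exact LinearMap.congr_fun (TensorProduct.map_id (R := k) (M := V) (N := V)) (s.comul x)
  · intro x; rfl
  · intro x; rfl

end HopfOps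

section Modules

variable {k : Type*} [Field k] {H K : Type*} [AddCommGroup H] [Module k H]
  [AddCommGroup K] [Module k K]

/-- `K` is a left `H`-module coalgebra via `act x a = x ⇀ a`: this is a left module structure,
and `H ⊗ K → K` is a homomorphism of coalgebras. -/
structure IsLeftModuleCoalgebra (s : HopfOps k H) (t : HopfOps k K)
    (act : H →ₗ[k] K →ₗ[k] K) : Prop where
  one_act : ∀ a, act s.one a = a
  mul_act : ∀ x y a, act (s.mul x y) a = act x (act y a)
  comul_act : ∀ x a, t.comul (act x a) =
    TensorProduct.map (TensorProduct.lift act) (TensorProduct.lift act)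
      (s.tensorComul t (x ⊗ₜ a))
  counit_act : ∀ x a, t.counit (act x a) = s.counit x * t.counit a

/-- `H` is a right `K`-module coalgebra via `ract x a = x ↼ a`: this is a right module
structure, and `H ⊗ K → H` is a homomorphism of coalgebras. -/
structure IsRightModuleCoalgebra (s : HopfOps k H) (t : HopfOps k K)
    (ract : H →ₗ[k] K →ₗ[k] H) : Prop where
  act_one : ∀ x, ract x t.one = x
  act_mul : ∀ x a b, ract x (t.mul a b) = ract (ract x a) b
  comul_act : ∀ x a, s.comul (ract x a) =
    TensorProduct.map (TensorProduct.lift ract) (TensorProduct.lift ract)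
      (s.tensorComul t (x ⊗ₜ a))
  counit_act : ∀ x a, s.counit (ract x a) = s.counit x * t.counit a

/-- `K` is a left `H`-module bialgebra via `act x a = x ⇀ a`: it is a left module coalgebra and
a left module algebra, i.e. `x ⇀ 1 = ε(x) 1` and `x ⇀ (a b) = (x₁ ⇀ a) (x₂ ⇀ b)`. -/
structure IsLeftModuleBialgebra (s : HopfOps k H) (t : HopfOps k K)
    (act : H →ₗ[k] K →ₗ[k] K) : Prop extends IsLeftModuleCoalgebra s t act where
  act_one : ∀ x, act x t.one = s.counit x • t.one
  act_mul : ∀ x a b, act x (t.mul a b) =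
    TensorProduct.lift t.mul (TensorProduct.map (act.flip a) (act.flip b) (s.comul x))

/-- `(H, K, ⇀, ↼)` is a matched pair of Hopf algebras, where `s`, `t` are the structures of
`H`, `K` and `act x a = x ⇀ a`, `ract x a = x ↼ a`. -/
structure IsMatchedPair (s : HopfOps k H) (t : HopfOps k K)
    (act : H →ₗ[k] K →ₗ[k] K) (ract : H →ₗ[k] K →ₗ[k] H) : Prop where
  hopf_left : s.IsHopfAlgebra
  hopf_right : t.IsHopfAlgebra
  left_module : IsLeftModuleCoalgebra s t act
  right_module : IsRightModuleCoalgebra s t ract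
  /-- `x ⇀ (a b) = (x₁ ⇀ a₁) ((x₂ ↼ a₂) ⇀ b)` -/
  act_mul : ∀ x a b, act x (t.mul a b) =
    TensorProduct.lift t.mul
      (TensorProduct.map (TensorProduct.lift act) (act.flip b ∘ₗ TensorProduct.lift ract)
        (s.tensorComul t (x ⊗ₜ a)))
  /-- `x ⇀ 1 = ε(x) 1` -/
  act_one : ∀ x, act x t.one = s.counit x • t.one
  /-- `(x y) ↼ a = (x ↼ (y₁ ⇀ a₁)) (y₂ ↼ a₂)` -/
  mul_ract : ∀ x y a, ract (s.mul x y) a =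
    TensorProduct.lift s.mul
      (TensorProduct.map (ract x ∘ₗ TensorProduct.lift act) (TensorProduct.lift ract)
        (s.tensorComul t (y ⊗ₜ a)))
  /-- `1 ↼ a = ε(a) 1` -/
  one_ract : ∀ a, ract s.one a = t.counit a • s.one
  /-- `(x₁ ↼ a₁) ⊗ (x₂ ⇀ a₂) = (x₂ ↼ a₂) ⊗ (x₁ ⇀ a₁)` -/
  compat : ∀ x a,
    TensorProduct.map (TensorProduct.lift ract) (TensorProduct.lift act)
        (s.tensorComul t (x ⊗ₜ a)) =
      TensorProduct.map (TensorProduct.lift ract) (TensorProduct.lift act)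
        (TensorProduct.comm k _ _ (s.tensorComul t (x ⊗ₜ a)))

/-- The product on `K ⊗ H` obtained from products on `K` and `H` and an exchange map
`θ : H ⊗ K → K ⊗ H`: `(a ⊗ x) (b ⊗ y) = a θ(x ⊗ b) y`; see `exchangeMul_tmul`. -/
def exchangeMul (mK : K →ₗ[k] K →ₗ[k] K) (mH : H →ₗ[k] H →ₗ[k] H)
    (θ : H ⊗[k] K →ₗ[k] K ⊗[k] H) : K ⊗[k] H →ₗ[k] K ⊗[k] H →ₗ[k] K ⊗[k] H :=
  TensorProduct.curry <|
    TensorProduct.map (TensorProduct.lift mK) (TensorProduct.lift mH) ∘ₗ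
    (TensorProduct.assoc k K K (H ⊗[k] H)).symm.toLinearMap ∘ₗ
    ((TensorProduct.assoc k K H H).toLinearMap ∘ₗ θ.rTensor H ∘ₗ
      (TensorProduct.assoc k H K H).symm.toLinearMap).lTensor K ∘ₗ
    (TensorProduct.assoc k K H (K ⊗[k] H)).toLinearMap

theorem exchangeMul_tmul (mK : K →ₗ[k] K →ₗ[k] K) (mH : H →ₗ[k] H →ₗ[k] H)
    (θ : H ⊗[k] K →ₗ[k] K ⊗[k] H) (a b : K) (x y : H) :
    exchangeMul mK mH θ (a ⊗ₜ x) (b ⊗ₜ y) =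
      TensorProduct.map (mK a) (mH.flip y) (θ (x ⊗ₜ b)) := by
  simp only [exchangeMul, TensorProduct.curry_apply, LinearMap.comp_apply,
    LinearEquiv.coe_coe, TensorProduct.assoc_tmul, LinearMap.lTensor_tmul,
    TensorProduct.assoc_symm_tmul, LinearMap.rTensor_tmul]
  induction θ (x ⊗ₜ b) using TensorProduct.induction_on with
  | zero => simp
  | tmul c z => simp
  | add u v hu hv => simp only [TensorProduct.add_tmul, map_add, TensorProduct.tmul_add, hu, hv]

/-- The double crossproduct `K ⋈ H` of a matched pair `(H, K, ⇀, ↼)`, on `K ⊗ H`: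
`(a ⊗ x) (b ⊗ y) = a (x₁ ⇀ b₁) ⊗ (x₂ ↼ b₂) y`, the tensor product coalgebra structure, and
`S(a ⊗ x) = (S(x₂) ⇀ S(a₂)) ⊗ (S(x₁) ↼ S(a₁))`. -/
def doubleCrossproduct (s : HopfOps k H) (t : HopfOps k K)
    (act : H →ₗ[k] K →ₗ[k] K) (ract : H →ₗ[k] K →ₗ[k] H) : HopfOps k (K ⊗[k] H) where
  mul := exchangeMul t.mul s.mul
    (TensorProduct.map (TensorProduct.lift act) (TensorProduct.lift ract) ∘ₗ s.tensorComul t)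
  one := t.one ⊗ₜ s.one
  comul := t.tensorComul s
  counit := t.tensorCounit s
  antipode :=
    TensorProduct.map
        (TensorProduct.lift act ∘ₗ TensorProduct.map s.antipode t.antipode)
        (TensorProduct.lift ract ∘ₗ TensorProduct.map s.antipode t.antipode) ∘ₗ
      (TensorProduct.comm k (H ⊗[k] K) (H ⊗[k] K)).toLinearMap ∘ₗ
      s.tensorComul t ∘ₗ (TensorProduct.comm k K H).toLinearMap

/-- The smash product `K ⋊ H`, on `K ⊗ H`: `(a # x) (b # y) = a (x₁ ⇀ b) # x₂ y`, the tensor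
product coalgebra structure, and `S(a # x) = (S(x₁) ⇀ S(a)) # S(x₂)`. -/
def smashProduct (s : HopfOps k H) (t : HopfOps k K) (act : H →ₗ[k] K →ₗ[k] K) :
    HopfOps k (K ⊗[k] H) where
  mul := exchangeMul t.mul s.mul
    ((TensorProduct.lift act).rTensor H ∘ₗ
      (TensorProduct.rightComm k H H K).toLinearMap ∘ₗ s.comul.rTensor K)
  one := t.one ⊗ₜ s.one
  comul := t.tensorComul s
  counit := t.tensorCounit s
  antipode :=
    (TensorProduct.lift act).rTensor H ∘ₗ
      (TensorProduct.rightComm k H H K).toLinearMap ∘ₗ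
      TensorProduct.map (TensorProduct.map s.antipode s.antipode ∘ₗ s.comul) t.antipode ∘ₗ
      (TensorProduct.comm k K H).toLinearMap

end Modules

section RotaBaxter

variable {k : Type*} [Field k] {H K : Type*} [Ring H] [HopfAlgebra k H]
  [Ring K] [HopfAlgebra k K]

/-- The product `a *_T b = a₁ (T(a₂) ⇀ b)` on `K`. -/
def descendentMul (act : H →ₗ[k] K →ₗ[k] K) (T : K →ₗc[k] H) : K →ₗ[k] K →ₗ[k] K :=
  TensorProduct.curry <|
    LinearMap.mul' k K ∘ₗ
    (TensorProduct.lift act ∘ₗ T.toLinearMap.rTensor K).lTensor K ∘ₗ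
    (TensorProduct.assoc k K K K).toLinearMap ∘ₗ
    (Coalgebra.comul (R := k) (A := K)).rTensor K

/-- The map `S_T(a) = S_H(T(a₁)) ⇀ S_K(a₂)` on `K`. -/
def descendentAntipode (act : H →ₗ[k] K →ₗ[k] K) (T : K →ₗc[k] H) : K →ₗ[k] K :=
  TensorProduct.lift act ∘ₗ
    TensorProduct.map (HopfAlgebra.antipode k ∘ₗ T.toLinearMap) (HopfAlgebra.antipode k) ∘ₗ
    Coalgebra.comul

/-- The coalgebra homomorphism `T : K → H` is a relative Rota-Baxter operator with respect to
the left `H`-module bialgebra `(K, ⇀)`: `T(a) T(b) = T(a₁ (T(a₂) ⇀ b))`. -/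
structure IsRelativeRotaBaxter (act : H →ₗ[k] K →ₗ[k] K) (T : K →ₗc[k] H) : Prop where
  moduleBialgebra : IsLeftModuleBialgebra (HopfOps.of k H) (HopfOps.of k K) act
  map_mul_map : ∀ a b, T a * T b = T (descendentMul act T a b)

/-- The descendent Hopf algebra `K_T = (K, *_T, 1, Δ, ε, S_T)`. -/
def descendent (act : H →ₗ[k] K →ₗ[k] K) (T : K →ₗc[k] H) : HopfOps k K where
  mul := descendentMul act T
  one := 1
  comul := Coalgebra.comul
  counit := Coalgebra.counit
  antipode := descendentAntipode act T

/-- The map `x ↼ a = S_H(T(x₁ ⇀ a₁)) x₂ T(a₂)`. -/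
def rightAction (act : H →ₗ[k] K →ₗ[k] K) (T : K →ₗc[k] H) : H →ₗ[k] K →ₗ[k] H :=
  TensorProduct.curry <|
    LinearMap.mul' k H ∘ₗ
    TensorProduct.map
      (HopfAlgebra.antipode k ∘ₗ T.toLinearMap ∘ₗ TensorProduct.lift act)
      (LinearMap.mul' k H ∘ₗ T.toLinearMap.lTensor H) ∘ₗ
    (HopfOps.of k H).tensorComul (HopfOps.of k K)

/-- The map `Φ_T(a ⊗ x) = a₁ ⊗ T(a₂) x` on `K ⊗ H`. -/
def twistMap (T : K →ₗc[k] H) : K ⊗[k] H →ₗ[k] K ⊗[k] H :=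
  (LinearMap.mul' k H ∘ₗ T.toLinearMap.rTensor H).lTensor K ∘ₗ
    (TensorProduct.assoc k K K H).toLinearMap ∘ₗ
    (Coalgebra.comul (R := k) (A := K)).rTensor H

end RotaBaxter

end RRB

end

/-!
Cocommutative Hopf algebras are the group objects among cocommutative coalgebras, where the tensor
product is the categorical product. So the theorem is a statement about groups, and is proved as
one, by the Yoneda principle.

For a cocommutative coalgebra `C`, the coalgebra homomorphisms `C → A` (`Point k C A`) into a
cocommutative Hopf algebra form a group under convolution. A module bialgebra gives an action of
the group of points of `H` on that of `K` by automorphisms (`IsLeftModuleBialgebra.action`), a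
relative Rota-Baxter operator gives a map between these groups with `T(a) T(b) = T(a (T(a) ⇀ b))`
(`IsGroupRotaBaxter`), and `↼` becomes `x ↼ a = T(x ⇀ a)⁻¹ x T(a)`. In groups all the required
identities follow from these formulas, mainly through `T(x ⇀ a) (x ↼ a) = x T(a)`.

An equality of linear maps on a tensor product of cocommutative coalgebras can be tested on tuples
of points (`Point.linearMap_ext₂` and its companions), because the identity is itself the pair of
the two projections. The lemmas named `..._comp_pairing` evaluate the structural maps of tensor
products on such tuples, which turns each Sweedler identity into the group identity it encodes.
Conversely, operations that induce group structures on points form a Hopf algebra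
(`isHopfAlgebra_of_points`): this applies to the descendent operations and to the smash product,
whose points are a semidirect product. The double crossproduct needs no such argument: the twist
map is `(a, x) ↦ (a, T(a) x)` on points, hence bijective and compatible with all the operations, and
the Hopf algebra axioms are transported from the smash product along it.
-/

noncomputable section

namespace RRB

open TensorProduct Coalgebra

/-! ### Pairings of linear maps on a coalgebra -/

section Pairing

variable {k : Type*} [CommRing k] {C D : Type*} [AddCommGroup C] [Module k C] [Coalgebra k C]
  [AddCommGroup D] [Module k D] [Coalgebra k D]
  {V W X Y V' W' : Type*} [AddCommGroup V] [Module k V] [AddCommGroup W] [Module k W]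
  [AddCommGroup X] [Module k X] [AddCommGroup Y] [Module k Y]
  [AddCommGroup V'] [Module k V'] [AddCommGroup W'] [Module k W']

/-- The pairing `c ↦ u(c₁) ⊗ v(c₂)` of two linear maps on a coalgebra. -/
def pairing (u : C →ₗ[k] V) (v : C →ₗ[k] W) : C →ₗ[k] V ⊗[k] W :=
  TensorProduct.map u v ∘ₗ comul

theorem map_comp_pairing (f : V →ₗ[k] V') (g : W →ₗ[k] W') (u : C →ₗ[k] V) (v : C →ₗ[k] W) :
    TensorProduct.map f g ∘ₗ pairing u v = pairing (f ∘ₗ u) (g ∘ₗ v) := by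
  simp only [pairing, TensorProduct.map_comp, LinearMap.comp_assoc]

theorem lTensor_comp_pairing (g : W →ₗ[k] W') (u : C →ₗ[k] V) (v : C →ₗ[k] W) :
    g.lTensor V ∘ₗ pairing u v = pairing u (g ∘ₗ v) := by
  rw [LinearMap.lTensor, map_comp_pairing, LinearMap.id_comp]

theorem rTensor_comp_pairing (f : V →ₗ[k] V') (u : C →ₗ[k] V) (v : C →ₗ[k] W) :
    f.rTensor W ∘ₗ pairing u v = pairing (f ∘ₗ u) v := by
  rw [LinearMap.rTensor, map_comp_pairing, LinearMap.id_comp]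

theorem assoc_comp_pairing (u : C →ₗ[k] V) (v : C →ₗ[k] W) (w : C →ₗ[k] X) :
    (TensorProduct.assoc k V W X).toLinearMap ∘ₗ pairing (pairing u v) w =
      pairing u (pairing v w) := by
  simp only [pairing]
  simp [coassoc_simps]

theorem assoc_symm_comp_pairing (u : C →ₗ[k] V) (v : C →ₗ[k] W) (w : C →ₗ[k] X) :
    (TensorProduct.assoc k V W X).symm.toLinearMap ∘ₗ pairing u (pairing v w) =
      pairing (pairing u v) w := by
  rw [← assoc_comp_pairing, ← LinearMap.comp_assoc, LinearEquiv.symm_comp, LinearMap.id_comp]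

theorem pairing_comp (u : C →ₗ[k] V) (v : C →ₗ[k] W) (h : D →ₗc[k] C) :
    pairing u v ∘ₗ h.toLinearMap = pairing (u ∘ₗ h.toLinearMap) (v ∘ₗ h.toLinearMap) := by
  simp only [pairing, LinearMap.comp_assoc, TensorProduct.map_comp, h.map_comp_comul]

theorem pairing_unit_left (e : V) (v : C →ₗ[k] W) :
    pairing (LinearMap.toSpanSingleton k V e ∘ₗ counit) v = TensorProduct.mk k V W e ∘ₗ v := by
  have h : pairing (LinearMap.toSpanSingleton k V e ∘ₗ counit) v =
      TensorProduct.map (LinearMap.toSpanSingleton k V e) v ∘ₗ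
        (counit.rTensor C ∘ₗ comul) := by
    simp only [pairing, LinearMap.rTensor, ← LinearMap.comp_assoc, ← TensorProduct.map_comp,
      LinearMap.comp_id]
  rw [h, rTensor_counit_comp_comul]
  ext c
  simp

theorem pairing_unit_right (u : C →ₗ[k] V) (e : W) :
    pairing u (LinearMap.toSpanSingleton k W e ∘ₗ counit) =
      (TensorProduct.mk k V W).flip e ∘ₗ u := by
  have h : pairing u (LinearMap.toSpanSingleton k W e ∘ₗ counit) =
      TensorProduct.map u (LinearMap.toSpanSingleton k W e) ∘ₗ
        (counit.lTensor C ∘ₗ comul) := by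
    simp only [pairing, LinearMap.lTensor, ← LinearMap.comp_assoc, ← TensorProduct.map_comp,
      LinearMap.comp_id]
  rw [h, lTensor_counit_comp_comul]
  ext c
  simp

variable [IsCocomm k C]

theorem comm_comp_pairing (u : C →ₗ[k] V) (v : C →ₗ[k] W) :
    (TensorProduct.comm k V W).toLinearMap ∘ₗ pairing u v = pairing v u := by
  simp only [pairing]
  rw [← LinearMap.comp_assoc, ← TensorProduct.map_comp_comm_eq, LinearMap.comp_assoc,
    IsCocomm.comm_comp_comul]

theorem rightComm_comp_pairing (u : C →ₗ[k] V) (v : C →ₗ[k] W) (w : C →ₗ[k] X) :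
    (TensorProduct.rightComm k V W X).toLinearMap ∘ₗ pairing (pairing u v) w =
      pairing (pairing u w) v := by
  simp only [pairing]
  simp [coassoc_simps]

/-- Exchanging the middle factors permutes the four maps, by cocommutativity. This is why the
pairing of two coalgebra homomorphisms is again one. -/
theorem tensorTensorTensorComm_comp_pairing (u : C →ₗ[k] V) (v : C →ₗ[k] W) (w : C →ₗ[k] X)
    (z : C →ₗ[k] Y) :
    (TensorProduct.tensorTensorTensorComm k V W X Y).toLinearMap ∘ₗ
        pairing (pairing u v) (pairing w z) =
      pairing (pairing u w) (pairing v z) := by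
  simp only [pairing]
  simp [coassoc_simps]

end Pairing

/-! ### Points of a coalgebra -/

section Points

/-- The `C`-points of a coalgebra `A`: the coalgebra homomorphisms `C → A`. A type of its own,
since `C →ₗc[k] C` already carries composition as its multiplication. -/
def Point (k C A : Type*) [CommRing k] [AddCommGroup C] [Module k C] [Coalgebra k C]
    [AddCommGroup A] [Module k A] [Coalgebra k A] : Type _ :=
  C →ₗc[k] A

namespace Point

variable {k : Type*} [CommRing k] {C A B V : Type*} [AddCommGroup C] [Module k C] [Coalgebra k C]
  [AddCommGroup A] [Module k A] [Coalgebra k A] [AddCommGroup B] [Module k B] [Coalgebra k B]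
  [AddCommGroup V] [Module k V]

/-- The linear map underlying a point. -/
def lin (p : Point k C A) : C →ₗ[k] A := CoalgHom.toLinearMap p

/-- A linear map compatible with comultiplication and counit, as a point. -/
def mk (u : C →ₗ[k] A) (hc : counit ∘ₗ u = counit) (hΔ : comul ∘ₗ u = pairing u u) :
    Point k C A :=
  { u with
    counit_comp := hc
    map_comp_comul := hΔ.symm }

@[ext] theorem ext {p q : Point k C A} (h : p.lin = q.lin) : p = q :=
  CoalgHom.coe_linearMap_injective h

theorem counit_comp_lin (p : Point k C A) : counit ∘ₗ p.lin = counit := CoalgHom.counit_comp p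

theorem comul_comp_lin (p : Point k C A) : comul ∘ₗ p.lin = pairing p.lin p.lin :=
  (CoalgHom.map_comp_comul p).symm

/-- The image of a point under a coalgebra homomorphism. -/
def map (f : A →ₗc[k] B) (p : Point k C A) : Point k C B := f.comp p

theorem lin_map (f : A →ₗc[k] B) (p : Point k C A) : (p.map f).lin = f.toLinearMap ∘ₗ p.lin :=
  rfl

theorem pairing_comp_lin {W : Type*} [AddCommGroup W] [Module k W] (u : A →ₗ[k] V)
    (v : A →ₗ[k] W) (p : Point k C A) :
    pairing u v ∘ₗ p.lin = pairing (u ∘ₗ p.lin) (v ∘ₗ p.lin) :=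
  pairing_comp u v p

/-- Linear maps on `A` agree as soon as they agree on all points of `A`; the universal point
`id : A → A` suffices. -/
theorem linearMap_ext {F G : A →ₗ[k] V} (h : ∀ p : Point k A A, F ∘ₗ p.lin = G ∘ₗ p.lin) :
    F = G :=
  h (CoalgHom.id k A)

theorem counit_comp_pairing (p : Point k C A) (q : Point k C B) :
    (counit : A ⊗[k] B →ₗ[k] k) ∘ₗ pairing p.lin q.lin = counit := by
  have h : (counit : A ⊗[k] B →ₗ[k] k) =
      (TensorProduct.rid k k).toLinearMap ∘ₗ TensorProduct.map counit counit := rfl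
  have h1 : (counit : C →ₗ[k] k) = LinearMap.toSpanSingleton k k 1 ∘ₗ counit := by ext; simp
  rw [h, LinearMap.comp_assoc, map_comp_pairing, p.counit_comp_lin, q.counit_comp_lin]
  nth_rw 1 [h1]
  rw [pairing_unit_left]
  ext; simp

section Cocomm

variable [IsCocomm k C]

/-- The point of `A ⊗ B` with components `p` and `q`: for cocommutative `C`, the tensor product
is the categorical product. -/
def pair (p : Point k C A) (q : Point k C B) : Point k C (A ⊗[k] B) :=
  mk (pairing p.lin q.lin) (counit_comp_pairing p q) <| by
    have h : (comul : A ⊗[k] B →ₗ[k] _) =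
      (TensorProduct.tensorTensorTensorComm k A A B B).toLinearMap ∘ₗ
        TensorProduct.map comul comul := rfl
    rw [h, LinearMap.comp_assoc, map_comp_pairing, p.comul_comp_lin, q.comul_comp_lin,
      tensorTensorTensorComm_comp_pairing]

theorem lin_pair (p : Point k C A) (q : Point k C B) : (pair p q).lin = pairing p.lin q.lin := rfl

end Cocomm

/-- The first projection `a ⊗ b ↦ ε(b) a`. -/
def fst (k A B : Type*) [CommRing k] [AddCommGroup A] [Module k A] [Coalgebra k A]
    [AddCommGroup B] [Module k B] [Coalgebra k B] : A ⊗[k] B →ₗc[k] A :=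
  (Coalgebra.TensorProduct.rid k k A : A ⊗[k] k →ₗc[k] A).comp
    (Coalgebra.TensorProduct.map (CoalgHom.id k A) (counitCoalgHom k B))

/-- The second projection `a ⊗ b ↦ ε(a) b`. -/
def snd (k A B : Type*) [CommRing k] [AddCommGroup A] [Module k A] [Coalgebra k A]
    [AddCommGroup B] [Module k B] [Coalgebra k B] : A ⊗[k] B →ₗc[k] B :=
  (Coalgebra.TensorProduct.lid k B : k ⊗[k] B →ₗc[k] B).comp
    (Coalgebra.TensorProduct.map (counitCoalgHom k A) (CoalgHom.id k B))

theorem pairing_fst_snd :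
    pairing (fst k A B).toLinearMap (snd k A B).toLinearMap = LinearMap.id := by
  have h : (comul : A ⊗[k] B →ₗ[k] _) =
      (TensorProduct.tensorTensorTensorComm k A A B B).toLinearMap ∘ₗ
        TensorProduct.map comul comul := rfl
  ext a b
  have ha := congr(TensorProduct.rid k A $(lTensor_counit_comul (R := k) a))
  have hb := congr(TensorProduct.lid k B $(rTensor_counit_comul (R := k) b))
  have key : ∀ (u : A ⊗[k] A) (v : B ⊗[k] B),
      TensorProduct.map (fst k A B).toLinearMap (snd k A B).toLinearMap
        (TensorProduct.tensorTensorTensorComm k A A B B (u ⊗ₜ v)) =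
      TensorProduct.rid k A (counit.lTensor A u) ⊗ₜ TensorProduct.lid k B (counit.rTensor B v) := by
    intro u v
    induction u with
    | zero => simp
    | add u u' hu hu' => simp only [add_tmul, map_add, hu, hu']
    | tmul a a' =>
      induction v with
      | zero => simp
      | add v v' hv hv' => simp only [tmul_add, map_add, hv, hv']
      | tmul b b' =>
        change (counit (R := k) b • a) ⊗ₜ[k] (counit (R := k) a' • b') =
          (counit (R := k) a' • a) ⊗ₜ[k] (counit (R := k) b • b')
        simp only [smul_tmul, tmul_smul, smul_smul, mul_comm]
  have := key (comul a) (comul b)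
  rw [ha, hb] at this
  simpa [pairing, h] using this

/-- Every point of `A ⊗ B` is the pair of its components. -/
theorem exists_eq_pair [IsCocomm k C] (r : Point k C (A ⊗[k] B)) :
    ∃ p q, r = pair (A := A) (B := B) p q := by
  refine ⟨r.map (fst k A B), r.map (snd k A B), ext ?_⟩
  rw [lin_pair, lin_map, lin_map, ← pairing_comp_lin, pairing_fst_snd, LinearMap.id_comp]

end Point

end Points

/-! ### Points of a cocommutative Hopf algebra -/

section Group

variable {k : Type*} [CommRing k] {C A : Type*} [AddCommGroup C] [Module k C] [Coalgebra k C]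
  [Ring A] [HopfAlgebra k A]

open HopfAlgebra

/-- The antipode of a cocommutative Hopf algebra is a coalgebra homomorphism: both `Δ ∘ S` and
`(S ⊗ S) ∘ Δ` are convolution inverse to `Δ`. -/
theorem comul_comp_antipode [IsCocomm k A] :
    comul ∘ₗ antipode k (A := A) = pairing (antipode k) (antipode k) := by
  apply WithConv.toConv_injective
  refine (left_inv_eq_right_inv (a := WithConv.toConv (comul : A →ₗ[k] A ⊗[k] A)) ?_
    LinearMap.comul_right_inv).symm
  rw [LinearMap.convMul_def]
  apply congrArg WithConv.toConv
  have h : (comul : A →ₗ[k] _) = pairing LinearMap.id LinearMap.id := by simp [pairing]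
  have hS : LinearMap.mul' k A ∘ₗ pairing (antipode k (A := A)) LinearMap.id =
      Algebra.linearMap k A ∘ₗ counit := mul_antipode_rTensor_comul
  have hm : LinearMap.mul' k (A ⊗[k] A) =
      TensorProduct.map (LinearMap.mul' k A) (LinearMap.mul' k A) ∘ₗ
        (TensorProduct.tensorTensorTensorComm k A A A A).toLinearMap := by
    ext; simp
  change LinearMap.mul' k (A ⊗[k] A) ∘ₗ pairing (pairing (antipode k) (antipode k)) comul = _
  rw [h, hm, LinearMap.comp_assoc, tensorTensorTensorComm_comp_pairing, map_comp_pairing, hS]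
  have h1 : Algebra.linearMap k A = LinearMap.toSpanSingleton k A 1 := by ext; simp
  rw [h1, pairing_unit_left]
  ext; simp [Algebra.TensorProduct.one_def, Algebra.algebraMap_eq_smul_one]

variable (k A) in
/-- The antipode of a cocommutative Hopf algebra as a coalgebra homomorphism. -/
def antipodeCoalgHom [IsCocomm k A] : A →ₗc[k] A :=
  Point.mk (antipode k) counit_comp_antipode comul_comp_antipode

namespace Point

instance : One (Point k C A) where
  one := mk (LinearMap.toSpanSingleton k A 1 ∘ₗ counit)
    (by ext; simp) (by
      rw [pairing_unit_left]
      ext; simp [Algebra.TensorProduct.one_def])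

theorem lin_one : (1 : Point k C A).lin = LinearMap.toSpanSingleton k A 1 ∘ₗ counit := rfl

section Inv

variable [IsCocomm k A]

instance : Inv (Point k C A) where
  inv p := p.map (antipodeCoalgHom k A)

theorem lin_inv (p : Point k C A) : (p⁻¹).lin = antipode k ∘ₗ p.lin := rfl

end Inv

variable [IsCocomm k C]

instance : Mul (Point k C A) where
  mul p q := (pair p q).map (Bialgebra.mulCoalgHom k A)

theorem lin_mul (p q : Point k C A) :
    (p * q).lin = LinearMap.mul' k A ∘ₗ pairing p.lin q.lin := rfl

variable [IsCocomm k A]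

/-- The points of a cocommutative Hopf algebra form a group under convolution. -/
instance : Group (Point k C A) where
  mul_assoc p q r := by
    ext1
    have h : LinearMap.mul' k A ∘ₗ (LinearMap.mul' k A).rTensor A =
        LinearMap.mul' k A ∘ₗ (LinearMap.mul' k A).lTensor A ∘ₗ
          (TensorProduct.assoc k A A A).toLinearMap := by
      ext; simp [mul_assoc]
    rw [lin_mul, lin_mul, lin_mul, lin_mul, ← rTensor_comp_pairing, ← lTensor_comp_pairing,
      ← LinearMap.comp_assoc, h, LinearMap.comp_assoc, LinearMap.comp_assoc, assoc_comp_pairing]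
  one_mul p := by
    ext1
    rw [lin_mul, lin_one, pairing_unit_left]
    ext; simp
  mul_one p := by
    ext1
    rw [lin_mul, lin_one, pairing_unit_right]
    ext; simp
  inv_mul_cancel p := by
    ext1
    have hS : LinearMap.mul' k A ∘ₗ pairing (antipode k (A := A)) LinearMap.id =
      Algebra.linearMap k A ∘ₗ counit := mul_antipode_rTensor_comul
    have h := congr($hS ∘ₗ p.lin)
    rw [LinearMap.comp_assoc, pairing_comp_lin, LinearMap.id_comp, LinearMap.comp_assoc,
      counit_comp_lin] at h
    rw [lin_mul, lin_inv, h, lin_one]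
    ext; simp [Algebra.algebraMap_eq_smul_one]

end Point

end Group

/-! ### Relative Rota-Baxter operators on groups -/

section RotaBaxterGroup

variable {G N : Type*} [Group G] [Group N]

/-- The product `a (T(a) ⇀ b)` attached to a map `T : N → G`, where `G` acts on `N` by `φ`. -/
def descMul (φ : G →* MulAut N) (T : N → G) (a b : N) : N := a * φ (T a) b

/-- The inverse `T(a)⁻¹ ⇀ a⁻¹` for `descMul`. -/
def descInv (φ : G →* MulAut N) (T : N → G) (a : N) : N := φ (T a)⁻¹ a⁻¹

/-- The map `x ↼ a = T(x ⇀ a)⁻¹ x T(a)`. -/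
def descAct (φ : G →* MulAut N) (T : N → G) (x : G) (a : N) : G := (T (φ x a))⁻¹ * x * T a

/-- Relative Rota-Baxter operators on groups: `T(a) T(b) = T(a (T(a) ⇀ b))`. -/
def IsGroupRotaBaxter (φ : G →* MulAut N) (T : N → G) : Prop :=
  ∀ a b, T a * T b = T (descMul φ T a b)

namespace IsGroupRotaBaxter

variable {φ : G →* MulAut N} {T : N → G}

theorem map_one (hT : IsGroupRotaBaxter φ T) : T 1 = 1 := by
  have h := hT 1 1
  rwa [descMul, _root_.map_one, mul_one, mul_eq_right] at h

theorem map_descInv (hT : IsGroupRotaBaxter φ T) (a : N) : T (descInv φ T a) = (T a)⁻¹ := by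
  apply eq_inv_of_mul_eq_one_right
  rw [hT]
  simp [descMul, descInv, hT.map_one]

theorem descMul_assoc (hT : IsGroupRotaBaxter φ T) (a b c : N) :
    descMul φ T (descMul φ T a b) c = descMul φ T a (descMul φ T b c) := by
  rw [descMul, ← hT]
  simp [descMul, mul_assoc]

theorem descMul_inv_self (hT : IsGroupRotaBaxter φ T) (a : N) :
    descMul φ T (descInv φ T a) a = 1 := by
  rw [descMul, hT.map_descInv, descInv, ← map_mul (φ (T a)⁻¹), inv_mul_cancel, _root_.map_one]

/-- The descendent group. -/
abbrev descGroup (hT : IsGroupRotaBaxter φ T) : Group N :=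
  @Group.ofLeftAxioms N ⟨descMul φ T⟩ ⟨descInv φ T⟩ ⟨1⟩ hT.descMul_assoc
    (fun a => show descMul φ T 1 a = a by simp [descMul, hT.map_one])
    hT.descMul_inv_self

theorem descAct_one (hT : IsGroupRotaBaxter φ T) (x : G) : descAct φ T x 1 = x := by
  simp [descAct, hT.map_one]

theorem one_descAct (a : N) : descAct φ T 1 a = 1 := by
  simp [descAct]

/-- `x ⇀ a` and `x ↼ a` factor `x T(a)`. -/
theorem map_mul_descAct (x : G) (a : N) : T (φ x a) * descAct φ T x a = x * T a := by
  simp [descAct, mul_assoc]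

theorem apply_descMul (x : G) (a b : N) :
    φ x (descMul φ T a b) = descMul φ T (φ x a) (φ (descAct φ T x a) b) := by
  rw [descMul, descMul, ← MulAut.mul_apply, ← map_mul φ, map_mul_descAct]
  simp

theorem descAct_descMul (hT : IsGroupRotaBaxter φ T) (x : G) (a b : N) :
    descAct φ T x (descMul φ T a b) = descAct φ T (descAct φ T x a) b := by
  rw [descAct, apply_descMul, ← hT, ← hT]
  simp [descAct, mul_assoc]

theorem mul_descAct (x y : G) (a : N) :
    descAct φ T (x * y) a = descAct φ T x (φ y a) * descAct φ T y a := by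
  simp [descAct, mul_assoc]

end IsGroupRotaBaxter

end RotaBaxterGroup

/-! ### Coordinates of points of tensor products -/

namespace Point

section Eval

variable {k : Type*} [CommRing k] {C A B V W X : Type*} [AddCommGroup C] [Module k C]
  [Coalgebra k C] [AddCommGroup A] [Module k A] [Coalgebra k A] [AddCommGroup B] [Module k B]
  [Coalgebra k B] [AddCommGroup V] [Module k V] [AddCommGroup W] [Module k W]
  [AddCommGroup X] [Module k X]

theorem fst_pair [IsCocomm k C] (p : Point k C A) (q : Point k C B) :
    (pair p q).map (fst k A B) = p := by
  ext1
  have h : (fst k A B).toLinearMap =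
    (TensorProduct.rid k A).toLinearMap ∘ₗ counit.lTensor A := rfl
  have h1 : (counit : C →ₗ[k] k) = LinearMap.toSpanSingleton k k 1 ∘ₗ counit := by ext; simp
  rw [lin_map, lin_pair, h, LinearMap.comp_assoc, lTensor_comp_pairing, q.counit_comp_lin, h1,
    pairing_unit_right]
  ext; simp

theorem snd_pair [IsCocomm k C] (p : Point k C A) (q : Point k C B) :
    (pair p q).map (snd k A B) = q := by
  ext1
  have h : (snd k A B).toLinearMap =
    (TensorProduct.lid k B).toLinearMap ∘ₗ counit.rTensor B := rfl
  have h1 : (counit : C →ₗ[k] k) = LinearMap.toSpanSingleton k k 1 ∘ₗ counit := by ext; simp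
  rw [lin_map, lin_pair, h, LinearMap.comp_assoc, rTensor_comp_pairing, p.counit_comp_lin, h1,
    pairing_unit_left]
  ext; simp

/-- Linear maps on `A ⊗ B` agree as soon as they agree on all pairs of points. -/
theorem linearMap_ext₂ [IsCocomm k A] [IsCocomm k B] {F G : A ⊗[k] B →ₗ[k] V}
    (h : ∀ (p : Point k (A ⊗[k] B) A) (q : Point k (A ⊗[k] B) B),
      F ∘ₗ pairing p.lin q.lin = G ∘ₗ pairing p.lin q.lin) : F = G := by
  refine linearMap_ext fun r => ?_
  obtain ⟨p, q, rfl⟩ := exists_eq_pair r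
  exact h p q

/-- Linear maps on `(A ⊗ B) ⊗ D` agree as soon as they agree on all triples of points. -/
theorem linearMap_ext₃ [IsCocomm k A] [IsCocomm k B] {D : Type*} [AddCommGroup D] [Module k D]
    [Coalgebra k D] [IsCocomm k D] {F G : (A ⊗[k] B) ⊗[k] D →ₗ[k] V}
    (h : ∀ (p : Point k ((A ⊗[k] B) ⊗[k] D) A) (q : Point k ((A ⊗[k] B) ⊗[k] D) B)
      (r : Point k ((A ⊗[k] B) ⊗[k] D) D),
      F ∘ₗ pairing (pairing p.lin q.lin) r.lin = G ∘ₗ pairing (pairing p.lin q.lin) r.lin) :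
    F = G := by
  refine linearMap_ext₂ fun s r => ?_
  obtain ⟨p, q, rfl⟩ := exists_eq_pair s
  exact h p q r

/-- Linear maps on `(A ⊗ B) ⊗ (D ⊗ E)` agree as soon as they agree on all quadruples of
points. -/
theorem linearMap_ext₄ [IsCocomm k A] [IsCocomm k B] {D E : Type*} [AddCommGroup D] [Module k D]
    [Coalgebra k D] [IsCocomm k D] [AddCommGroup E] [Module k E] [Coalgebra k E] [IsCocomm k E]
    {F G : (A ⊗[k] B) ⊗[k] (D ⊗[k] E) →ₗ[k] V}
    (h : ∀ (p : Point k ((A ⊗[k] B) ⊗[k] (D ⊗[k] E)) A)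
      (q : Point k ((A ⊗[k] B) ⊗[k] (D ⊗[k] E)) B)
      (r : Point k ((A ⊗[k] B) ⊗[k] (D ⊗[k] E)) D)
      (s : Point k ((A ⊗[k] B) ⊗[k] (D ⊗[k] E)) E),
      F ∘ₗ pairing (pairing p.lin q.lin) (pairing r.lin s.lin) =
        G ∘ₗ pairing (pairing p.lin q.lin) (pairing r.lin s.lin)) :
    F = G := by
  refine linearMap_ext₃ fun p q t => ?_
  obtain ⟨r, s, rfl⟩ := exists_eq_pair t
  exact h p q r s

end Eval

end Point

/-! ### Hopf algebras from groups of points -/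

section HopfOfPoints

universe v

variable {k : Type*} [Field k] {V : Type v} [AddCommGroup V] [Module k V] [Coalgebra k V]
  [IsCocomm k V]

/-- Operations on a cocommutative coalgebra which induce group structures on its points
form a Hopf algebra: every axiom is an equality of linear maps on a tensor power of `V`, and is
the corresponding group law for the universal points of that tensor power. The hypothesis
`counit_one` excludes `V = 0`, whose points also form (trivial) groups. -/
theorem isHopfAlgebra_of_points (s : HopfOps k V) (comul_eq : s.comul = comul)
    (counit_eq : s.counit = counit)
    (counit_one : counit (R := k) s.one = 1)
    (G : ∀ (C : Type v) [AddCommGroup C] [Module k C] [Coalgebra k C] [IsCocomm k C],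
      Group (Point k C V))
    (lin_one : ∀ (C : Type v) [AddCommGroup C] [Module k C] [Coalgebra k C] [IsCocomm k C],
      Point.lin (G C).one = LinearMap.toSpanSingleton k V s.one ∘ₗ counit)
    (lin_mul : ∀ (C : Type v) [AddCommGroup C] [Module k C] [Coalgebra k C] [IsCocomm k C]
      (p q : Point k C V),
      Point.lin ((G C).mul p q) = TensorProduct.lift s.mul ∘ₗ pairing p.lin q.lin)
    (lin_inv : ∀ (C : Type v) [AddCommGroup C] [Module k C] [Coalgebra k C] [IsCocomm k C]
      (p : Point k C V), Point.lin ((G C).inv p) = s.antipode ∘ₗ p.lin) :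
    s.IsHopfAlgebra := by
  have comul_one : comul (R := k) s.one = s.one ⊗ₜ s.one := by
    have h := congr($(Point.comul_comp_lin (G V).one) s.one)
    rw [lin_one, pairing_unit_left] at h
    simpa [counit_one] using h
  have comul_mul : comul ∘ₗ TensorProduct.lift s.mul =
      TensorProduct.map (TensorProduct.lift s.mul) (TensorProduct.lift s.mul) ∘ₗ comul :=
    Point.linearMap_ext fun r => by
      obtain ⟨p, q, rfl⟩ := Point.exists_eq_pair r
      rw [LinearMap.comp_assoc, LinearMap.comp_assoc, Point.comul_comp_lin, map_comp_pairing,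
        Point.lin_pair, ← lin_mul, Point.comul_comp_lin]
  have counit_mul : counit ∘ₗ TensorProduct.lift s.mul = counit :=
    Point.linearMap_ext fun r => by
      obtain ⟨p, q, rfl⟩ := Point.exists_eq_pair r
      rw [LinearMap.comp_assoc, Point.counit_comp_lin, Point.lin_pair, ← lin_mul,
        Point.counit_comp_lin]
  have mul_assoc : TensorProduct.lift s.mul ∘ₗ (TensorProduct.lift s.mul).rTensor V =
      TensorProduct.lift s.mul ∘ₗ (TensorProduct.lift s.mul).lTensor V ∘ₗ
        (TensorProduct.assoc k V V V).toLinearMap :=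
    Point.linearMap_ext₃ fun p q r => by
      simp only [LinearMap.comp_assoc, assoc_comp_pairing, rTensor_comp_pairing,
        lTensor_comp_pairing, ← lin_mul]
      exact congrArg Point.lin ((G _).mul_assoc p q r)
  have one_mul : s.mul s.one = LinearMap.id :=
    Point.linearMap_ext fun p => by
      have h := congrArg Point.lin ((G V).one_mul p)
      change Point.lin ((G V).mul (G V).one p) = p.lin at h
      rw [lin_mul, lin_one, pairing_unit_left] at h
      exact h
  have mul_one : s.mul.flip s.one = LinearMap.id :=
    Point.linearMap_ext fun p => by
      have h := congrArg Point.lin ((G V).mul_one p)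
      change Point.lin ((G V).mul p (G V).one) = p.lin at h
      rw [lin_mul, lin_one, pairing_unit_right] at h
      exact h
  have antipode_left : TensorProduct.lift s.mul ∘ₗ s.antipode.rTensor V ∘ₗ comul =
      LinearMap.toSpanSingleton k V s.one ∘ₗ counit :=
    Point.linearMap_ext fun p => by
      have h := congrArg Point.lin ((G V).inv_mul_cancel p)
      change Point.lin ((G V).mul ((G V).inv p) p) = Point.lin (G V).one at h
      rw [lin_mul, lin_one, lin_inv] at h
      rw [LinearMap.comp_assoc, LinearMap.comp_assoc, LinearMap.comp_assoc,
        Point.comul_comp_lin, rTensor_comp_pairing, Point.counit_comp_lin, h]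
  have antipode_right : TensorProduct.lift s.mul ∘ₗ s.antipode.lTensor V ∘ₗ comul =
      LinearMap.toSpanSingleton k V s.one ∘ₗ counit :=
    Point.linearMap_ext fun p => by
      have h := congrArg Point.lin (@mul_inv_cancel _ (G V) p)
      change Point.lin ((G V).mul p ((G V).inv p)) = Point.lin (G V).one at h
      rw [lin_mul, lin_one, lin_inv] at h
      rw [LinearMap.comp_assoc, LinearMap.comp_assoc, LinearMap.comp_assoc,
        Point.comul_comp_lin, lTensor_comp_pairing, Point.counit_comp_lin, h]
  have map₂_eq (u v : V ⊗[k] V) : TensorProduct.map₂ s.mul s.mul u v =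
      TensorProduct.map (TensorProduct.lift s.mul) (TensorProduct.lift s.mul)
        (TensorProduct.tensorTensorTensorComm k V V V V (u ⊗ₜ v)) := by
    induction u with
    | zero => simp
    | add u u' hu hu' => simp only [add_tmul, map_add, LinearMap.add_apply, hu, hu']
    | tmul a b =>
      induction v with
      | zero => simp
      | add v v' hv hv' => simp only [tmul_add, map_add, hv, hv']
      | tmul c d => simp
  refine s.isHopfAlgebra_of_axioms (fun x y z => congr($mul_assoc ((x ⊗ₜ y) ⊗ₜ z)))
    (fun x => congr($one_mul x)) (fun x => congr($mul_one x)) (fun x => ?_) (fun x => ?_)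
    (fun x => ?_) ?_ (fun x y => ?_) ?_ (fun x y => ?_) (fun x => ?_) (fun x => ?_)
  · rw [comul_eq]; exact coassoc_apply x
  · rw [comul_eq, counit_eq]; exact rTensor_counit_comul x
  · rw [comul_eq, counit_eq]; exact lTensor_counit_comul x
  · rw [counit_eq, counit_one]
  · have h := congr($counit_mul (x ⊗ₜ y))
    rw [counit_eq, mul_comm]
    exact h
  · rw [comul_eq, comul_one]
  · rw [comul_eq, map₂_eq]
    exact congr($comul_mul (x ⊗ₜ y))
  · rw [comul_eq, counit_eq]; exact congr($antipode_left x)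
  · rw [comul_eq, counit_eq]; exact congr($antipode_right x)

end HopfOfPoints

/-! ### Module bialgebras as actions on points -/

section Action

variable {k : Type*} [Field k] {C H K : Type*} [AddCommGroup C] [Module k C] [Coalgebra k C]
  [IsCocomm k C] [Ring H] [HopfAlgebra k H] [Ring K] [HopfAlgebra k K] {act : H →ₗ[k] K →ₗ[k] K}

theorem tensorComul_comp_pairing {A B : Type*} [AddCommGroup A] [Module k A] [Coalgebra k A]
    [AddCommGroup B] [Module k B] [Coalgebra k B] (s : HopfOps k A) (t : HopfOps k B)
    (hs : s.comul = comul) (ht : t.comul = comul) (p : Point k C A) (q : Point k C B) :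
    s.tensorComul t ∘ₗ pairing p.lin q.lin =
      pairing (pairing p.lin q.lin) (pairing p.lin q.lin) := by
  rw [HopfOps.tensorComul, hs, ht]
  exact (Point.pair p q).comul_comp_lin

namespace IsLeftModuleBialgebra

/-- The action of a module bialgebra, as a coalgebra homomorphism. -/
def actCoalgHom (h : IsLeftModuleBialgebra (HopfOps.of k H) (HopfOps.of k K) act) :
    H ⊗[k] K →ₗc[k] K where
  toLinearMap := TensorProduct.lift act
  counit_comp := TensorProduct.ext' fun x a => (h.counit_act x a).trans (mul_comm _ _)
  map_comp_comul := TensorProduct.ext' fun x a => (h.comul_act x a).symm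

/-- The action on points. -/
def smul (h : IsLeftModuleBialgebra (HopfOps.of k H) (HopfOps.of k K) act)
    (x : Point k C H) (a : Point k C K) : Point k C K :=
  (Point.pair x a).map h.actCoalgHom

variable (h : IsLeftModuleBialgebra (HopfOps.of k H) (HopfOps.of k K) act)

theorem lin_smul (x : Point k C H) (a : Point k C K) :
    (h.smul x a).lin = TensorProduct.lift act ∘ₗ pairing x.lin a.lin := rfl

theorem one_smul (a : Point k C K) : h.smul 1 a = a := by
  ext1
  rw [lin_smul, Point.lin_one, pairing_unit_left]
  ext c
  exact h.one_act _

theorem mul_smul (x y : Point k C H) (a : Point k C K) :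
    h.smul (x * y) a = h.smul x (h.smul y a) := by
  ext1
  have e : TensorProduct.lift act ∘ₗ (LinearMap.mul' k H).rTensor K =
      TensorProduct.lift act ∘ₗ (TensorProduct.lift act).lTensor H ∘ₗ
        (TensorProduct.assoc k H H K).toLinearMap :=
    TensorProduct.ext_threefold fun x y a => h.mul_act x y a
  rw [lin_smul, lin_smul, lin_smul, Point.lin_mul, ← rTensor_comp_pairing,
    ← lTensor_comp_pairing, ← LinearMap.comp_assoc, e, LinearMap.comp_assoc,
    LinearMap.comp_assoc, assoc_comp_pairing]

theorem smul_mul (x : Point k C H) (a b : Point k C K) :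
    h.smul x (a * b) = h.smul x a * h.smul x b := by
  ext1
  have e₀ (u : H ⊗[k] H) (a b : K) :
      TensorProduct.map (act.flip a) (act.flip b) u =
        TensorProduct.map (TensorProduct.lift act) (TensorProduct.lift act)
          (TensorProduct.tensorTensorTensorComm k H H K K (u ⊗ₜ (a ⊗ₜ b))) := by
    induction u with
    | zero => simp
    | add u u' hu hu' => simp only [add_tmul, map_add, hu, hu']
    | tmul x y => simp
  have e : TensorProduct.lift act ∘ₗ (LinearMap.mul' k K).lTensor H =
      LinearMap.mul' k K ∘ₗ
        TensorProduct.map (TensorProduct.lift act) (TensorProduct.lift act) ∘ₗ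
        (TensorProduct.tensorTensorTensorComm k H H K K).toLinearMap ∘ₗ
        comul.rTensor (K ⊗[k] K) := by
    refine TensorProduct.ext_threefold' fun x a b => ?_
    have := h.act_mul x a b
    rw [e₀] at this
    exact this
  rw [lin_smul, Point.lin_mul, Point.lin_mul, lin_smul, lin_smul, ← lTensor_comp_pairing,
    ← LinearMap.comp_assoc, e]
  simp only [LinearMap.comp_assoc, rTensor_comp_pairing, Point.comul_comp_lin,
    tensorTensorTensorComm_comp_pairing, map_comp_pairing]

variable [IsCocomm k H] [IsCocomm k K]

/-- The points of `H` act on the points of `K` by group automorphisms. -/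
def action : Point k C H →* MulAut (Point k C K) :=
  let _ : MulDistribMulAction (Point k C H) (Point k C K) :=
    { smul := h.smul
      one_smul := h.one_smul
      mul_smul := h.mul_smul
      smul_mul := h.smul_mul
      smul_one := fun x => by
        have e := h.smul_mul x 1 1
        rw [mul_one] at e
        exact left_eq_mul.mp e }
  MulDistribMulAction.toMulAut _ _

theorem lin_action (x : Point k C H) (a : Point k C K) :
    (h.action x a).lin = TensorProduct.lift act ∘ₗ pairing x.lin a.lin := rfl

end IsLeftModuleBialgebra

end Action

/-! ### The smash product -/

section Smash

/-- On points, the exchange map `θ` enters the product of `(a, x)` and `(b, y)` only through its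
value `(c, z)` at `(x, b)`. -/
theorem exchangeMul_comp_pairing {k : Type*} [Field k] {C V W : Type*} [AddCommGroup C]
    [Module k C] [Coalgebra k C] [AddCommGroup V] [Module k V] [AddCommGroup W]
    [Module k W] (mV : V →ₗ[k] V →ₗ[k] V)
    (mW : W →ₗ[k] W →ₗ[k] W) (θ : W ⊗[k] V →ₗ[k] V ⊗[k] W) (a b c : C →ₗ[k] V)
    (x y z : C →ₗ[k] W) (hθ : θ ∘ₗ pairing x b = pairing c z) :
    TensorProduct.lift (exchangeMul mV mW θ) ∘ₗ pairing (pairing a x) (pairing b y) =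
      pairing (TensorProduct.lift mV ∘ₗ pairing a c) (TensorProduct.lift mW ∘ₗ pairing z y) := by
  have e : TensorProduct.lift (exchangeMul mV mW θ) =
      TensorProduct.map (TensorProduct.lift mV) (TensorProduct.lift mW) ∘ₗ
      (TensorProduct.assoc k V V (W ⊗[k] W)).symm.toLinearMap ∘ₗ
      ((TensorProduct.assoc k V W W).toLinearMap ∘ₗ θ.rTensor W ∘ₗ
        (TensorProduct.assoc k W V W).symm.toLinearMap).lTensor V ∘ₗ
      (TensorProduct.assoc k V W (V ⊗[k] W)).toLinearMap :=
    TensorProduct.ext' fun _ _ => rfl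
  simp only [e, LinearMap.comp_assoc, assoc_comp_pairing, lTensor_comp_pairing,
    assoc_symm_comp_pairing, rTensor_comp_pairing, hθ, map_comp_pairing]

variable {k : Type*} [Field k] {C H K : Type*} [AddCommGroup C] [Module k C] [Coalgebra k C]
  [IsCocomm k C] [Ring H] [HopfAlgebra k H] [Ring K] [HopfAlgebra k K] {act : H →ₗ[k] K →ₗ[k] K}

variable [IsCocomm k H] [IsCocomm k K]

/-- The points of `K ⊗ H` are the pairs of points of `K` and `H`, here viewed as elements of a
semidirect product. -/
def pointEquivSemidirect (h : IsLeftModuleBialgebra (HopfOps.of k H) (HopfOps.of k K) act) :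
    Point k C (K ⊗[k] H) ≃ Point k C K ⋊[h.action] Point k C H where
  toFun r := ⟨r.map (Point.fst k K H), r.map (Point.snd k K H)⟩
  invFun p := Point.pair p.left p.right
  left_inv r := by
    obtain ⟨p, q, rfl⟩ := Point.exists_eq_pair r
    simp only [Point.fst_pair, Point.snd_pair]
  right_inv p := by
    ext1
    · exact Point.fst_pair _ _
    · exact Point.snd_pair _ _

theorem pointEquivSemidirect_pair
    (h : IsLeftModuleBialgebra (HopfOps.of k H) (HopfOps.of k K) act)
    (a : Point k C K) (x : Point k C H) : pointEquivSemidirect h (Point.pair a x) = ⟨a, x⟩ :=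
  (pointEquivSemidirect h).apply_symm_apply ⟨a, x⟩

variable (h : IsLeftModuleBialgebra (HopfOps.of k H) (HopfOps.of k K) act)

/-- On points, `(a, x) (b, y) = (a (x ⇀ b), x y)`. -/
theorem lift_smashProduct_mul (a b : Point k C K) (x y : Point k C H) :
    TensorProduct.lift (smashProduct (HopfOps.of k H) (HopfOps.of k K) act).mul ∘ₗ
        pairing (pairing a.lin x.lin) (pairing b.lin y.lin) =
      pairing (a * h.action x b).lin (x * y).lin := by
  refine exchangeMul_comp_pairing _ _ _ _ _ (h.action x b).lin _ _ x.lin ?_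
  have e : (HopfOps.of k H).comul = comul := rfl
  rw [e, LinearMap.comp_assoc, LinearMap.comp_assoc, rTensor_comp_pairing, x.comul_comp_lin,
    rightComm_comp_pairing, rTensor_comp_pairing, h.lin_action]

/-- On points, `S(a, x) = (x⁻¹ ⇀ a⁻¹, x⁻¹)`. -/
theorem smashProduct_antipode_comp (a : Point k C K) (x : Point k C H) :
    (smashProduct (HopfOps.of k H) (HopfOps.of k K) act).antipode ∘ₗ pairing a.lin x.lin =
      pairing (h.action x⁻¹ a⁻¹).lin (x⁻¹).lin := by
  have e : (HopfOps.of k H).comul = comul := rfl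
  have e₁ : (HopfOps.of k H).antipode = HopfAlgebra.antipode k := rfl
  have e₂ : (HopfOps.of k K).antipode = HopfAlgebra.antipode k := rfl
  rw [smashProduct]
  simp only [e, e₁, e₂, LinearMap.comp_assoc, comm_comp_pairing, map_comp_pairing,
    x.comul_comp_lin, ← Point.lin_inv, rightComm_comp_pairing, rTensor_comp_pairing,
    ← h.lin_action]

include h in
/-- The points of the smash product form the semidirect product of the points of `K` and `H`. -/
theorem isHopfAlgebra_smashProduct :
    (smashProduct (HopfOps.of k H) (HopfOps.of k K) act).IsHopfAlgebra := by
  refine isHopfAlgebra_of_points _ rfl ?_ ?_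
    (fun C _ _ _ _ => (pointEquivSemidirect (C := C) h).group) ?_ ?_ ?_
  -- Mathlib's counit of `K ⊗ H` is the product of the counits in the opposite order.
  · exact TensorProduct.ext' fun x a => mul_comm _ _
  · simp [smashProduct, HopfOps.of]
  · intro C _ _ _ _
    change pairing (1 : Point k C K).lin (1 : Point k C H).lin = _
    rw [Point.lin_one, Point.lin_one, pairing_unit_left]
    ext; simp [smashProduct, HopfOps.of]
  · intro C _ _ _ _ r s
    obtain ⟨a, x, rfl⟩ := Point.exists_eq_pair r
    obtain ⟨b, y, rfl⟩ := Point.exists_eq_pair s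
    rw [Point.lin_pair, Point.lin_pair, lift_smashProduct_mul h]
    change Point.lin ((pointEquivSemidirect h).symm (pointEquivSemidirect h (Point.pair a x) *
      pointEquivSemidirect h (Point.pair b y))) = _
    rw [pointEquivSemidirect_pair, pointEquivSemidirect_pair]
    rfl
  · intro C _ _ _ _ r
    obtain ⟨a, x, rfl⟩ := Point.exists_eq_pair r
    rw [Point.lin_pair, smashProduct_antipode_comp h]
    change Point.lin ((pointEquivSemidirect h).symm
      (pointEquivSemidirect h (Point.pair a x))⁻¹) = _
    rw [pointEquivSemidirect_pair]
    rfl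

end Smash

/-! ### Transport of Hopf algebra structures -/

namespace HopfOps

universe v

/-- Being a Hopf algebra is transported along isomorphisms. -/
theorem IsHopfIso.isHopfAlgebra {k : Type*} [Field k] {V W : Type v} [AddCommGroup V]
    [Module k V] [AddCommGroup W] [Module k W] {s : HopfOps k V} {t : HopfOps k W}
    {f : V →ₗ[k] W} (hf : s.IsHopfIso t f) (ht : t.IsHopfAlgebra) : s.IsHopfAlgebra := by
  obtain ⟨A, _, _, e, he⟩ := ht
  have hmap : ∀ u, TensorProduct.map ((LinearEquiv.ofBijective f hf.bijective).trans e).toLinearMap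
      ((LinearEquiv.ofBijective f hf.bijective).trans e).toLinearMap u =
      TensorProduct.map e.toLinearMap e.toLinearMap (TensorProduct.map f f u) := fun u =>
    LinearMap.congr_fun (TensorProduct.map_comp e.toLinearMap e.toLinearMap f f) u
  refine ⟨A, _, _, (LinearEquiv.ofBijective f hf.bijective).trans e, ⟨?_, ?_, ?_, ?_, ?_⟩⟩
  · intro x y
    simp [hf.map_mul, he.map_mul]
  · simp [hf.map_one, he.map_one]
  · intro x
    rw [hmap, hf.map_comul, he.map_comul]
    rfl
  · intro x
    rw [← hf.map_counit, he.map_counit]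
    rfl
  · intro x
    simp [hf.map_antipode, he.map_antipode]

end HopfOps

/-! ### The descendent Hopf algebra and its matched pair -/

section Descendent

variable {k : Type*} [Field k] {C H K : Type*} [AddCommGroup C] [Module k C] [Coalgebra k C]
  [IsCocomm k C] [Ring H] [HopfAlgebra k H] [IsCocomm k H] [Ring K] [HopfAlgebra k K]
  [IsCocomm k K] {act : H →ₗ[k] K →ₗ[k] K} {T : K →ₗc[k] H}

theorem lin_descMul (h : IsLeftModuleBialgebra (HopfOps.of k H) (HopfOps.of k K) act)
    (a b : Point k C K) :
    (descMul h.action (Point.map T) a b).lin =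
      TensorProduct.lift (descendentMul act T) ∘ₗ pairing a.lin b.lin := by
  have e : TensorProduct.lift (descendentMul act T) =
      LinearMap.mul' k K ∘ₗ (TensorProduct.lift act ∘ₗ T.toLinearMap.rTensor K).lTensor K ∘ₗ
        (TensorProduct.assoc k K K K).toLinearMap ∘ₗ
        (Coalgebra.comul (R := k) (A := K)).rTensor K := TensorProduct.ext' fun _ _ => rfl
  simp only [e, descMul, Point.lin_mul, h.lin_action, Point.lin_map, LinearMap.comp_assoc,
    rTensor_comp_pairing, Point.comul_comp_lin, assoc_comp_pairing, lTensor_comp_pairing]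

theorem lin_descInv (h : IsLeftModuleBialgebra (HopfOps.of k H) (HopfOps.of k K) act)
    (a : Point k C K) :
    (descInv h.action (Point.map T) a).lin = descendentAntipode act T ∘ₗ a.lin := by
  simp only [descendentAntipode, descInv, Point.lin_inv, h.lin_action, Point.lin_map,
    LinearMap.comp_assoc, Point.comul_comp_lin, map_comp_pairing]

theorem lin_descAct (h : IsLeftModuleBialgebra (HopfOps.of k H) (HopfOps.of k K) act)
    (x : Point k C H) (a : Point k C K) :
    (descAct h.action (Point.map T) x a).lin =
      TensorProduct.lift (rightAction act T) ∘ₗ pairing x.lin a.lin := by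
  have e : TensorProduct.lift (rightAction act T) =
      LinearMap.mul' k H ∘ₗ
      TensorProduct.map
        (HopfAlgebra.antipode k ∘ₗ T.toLinearMap ∘ₗ TensorProduct.lift act)
        (LinearMap.mul' k H ∘ₗ T.toLinearMap.lTensor H) ∘ₗ
      (HopfOps.of k H).tensorComul (HopfOps.of k K) := TensorProduct.ext' fun _ _ => rfl
  simp only [e, descAct, mul_assoc, Point.lin_mul, Point.lin_inv, h.lin_action, Point.lin_map,
    LinearMap.comp_assoc, map_comp_pairing, lTensor_comp_pairing,
    tensorComul_comp_pairing (HopfOps.of k H) (HopfOps.of k K) rfl rfl]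

namespace IsRelativeRotaBaxter

variable (hT : IsRelativeRotaBaxter act T)
include hT

/-- A relative Rota-Baxter operator induces relative Rota-Baxter operators on groups of points. -/
theorem isGroupRotaBaxter :
    IsGroupRotaBaxter hT.moduleBialgebra.action (Point.map (C := C) T) := fun a b => by
  ext1
  have e : LinearMap.mul' k H ∘ₗ TensorProduct.map T.toLinearMap T.toLinearMap =
      T.toLinearMap ∘ₗ TensorProduct.lift (descendentMul act T) :=
    TensorProduct.ext' hT.map_mul_map
  rw [Point.lin_map, lin_descMul, ← LinearMap.comp_assoc, ← e, LinearMap.comp_assoc,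
    map_comp_pairing]
  rfl

theorem map_one : T 1 = 1 := by
  have h := congr(Point.lin $((hT.isGroupRotaBaxter (C := K)).map_one) 1)
  rw [Point.lin_map, Point.lin_one, Point.lin_one] at h
  simpa using h

theorem isHopfAlgebra_descendent : (descendent act T).IsHopfAlgebra :=
  isHopfAlgebra_of_points _ rfl rfl Bialgebra.counit_one
    (fun _ _ _ _ _ => hT.isGroupRotaBaxter.descGroup) (fun _ _ _ _ _ => Point.lin_one)
    (fun _ _ _ _ _ => lin_descMul hT.moduleBialgebra)
    (fun _ _ _ _ _ => lin_descInv hT.moduleBialgebra)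

/-- The axioms for `↼` hold on points, where they are the identities for `descAct`. -/
theorem isRightModuleCoalgebra :
    IsRightModuleCoalgebra (HopfOps.of k H) (descendent act T) (rightAction act T) where
  act_one := by
    have e : (rightAction act T).flip 1 = LinearMap.id := Point.linearMap_ext fun x => by
      have h := lin_descAct (T := T) hT.moduleBialgebra x 1
      rw [Point.lin_one, pairing_unit_right, hT.isGroupRotaBaxter.descAct_one] at h
      exact h.symm
    exact fun x => congr($e x)
  act_mul := by
    have e : TensorProduct.lift (rightAction act T) ∘ₗ
          (TensorProduct.lift (descendentMul act T)).lTensor H ∘ₗ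
          (TensorProduct.assoc k H K K).toLinearMap =
        TensorProduct.lift (rightAction act T) ∘ₗ
          (TensorProduct.lift (rightAction act T)).rTensor K :=
      Point.linearMap_ext₃ fun x a b => by
        simp only [LinearMap.comp_assoc, assoc_comp_pairing, lTensor_comp_pairing,
          rTensor_comp_pairing, ← lin_descMul hT.moduleBialgebra,
          ← lin_descAct hT.moduleBialgebra, hT.isGroupRotaBaxter.descAct_descMul]
    exact fun x a b => congr($e ((x ⊗ₜ a) ⊗ₜ b))
  comul_act := by
    have e : comul ∘ₗ TensorProduct.lift (rightAction act T) =
        TensorProduct.map (TensorProduct.lift (rightAction act T))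
          (TensorProduct.lift (rightAction act T)) ∘ₗ
          (HopfOps.of k H).tensorComul (descendent act T) :=
      Point.linearMap_ext₂ fun x a => by
        simp only [LinearMap.comp_assoc, map_comp_pairing, ← lin_descAct hT.moduleBialgebra,
          tensorComul_comp_pairing (HopfOps.of k H) (descendent act T) rfl rfl,
          Point.comul_comp_lin]
    exact fun x a => congr($e (x ⊗ₜ a))
  counit_act := by
    have e : counit ∘ₗ TensorProduct.lift (rightAction act T) =
        (counit : H ⊗[k] K →ₗ[k] k) :=
      Point.linearMap_ext₂ fun x a => by
        rw [LinearMap.comp_assoc, ← lin_descAct hT.moduleBialgebra, Point.counit_comp_lin,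
          Point.counit_comp_pairing]
    exact fun x a => congr($e (x ⊗ₜ a)).trans (mul_comm _ _)

/-- The matched pair identities hold on points, by the group identities for `descMul` and
`descAct`; the exchange identity is cocommutativity. -/
theorem isMatchedPair :
    IsMatchedPair (HopfOps.of k H) (descendent act T) act (rightAction act T) where
  hopf_left := HopfOps.isHopfAlgebra_of k H
  hopf_right := hT.isHopfAlgebra_descendent
  left_module :=
    { one_act := hT.moduleBialgebra.one_act
      mul_act := hT.moduleBialgebra.mul_act
      comul_act := hT.moduleBialgebra.comul_act
      counit_act := hT.moduleBialgebra.counit_act }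
  right_module := hT.isRightModuleCoalgebra
  act_mul := by
    have e : TensorProduct.lift act ∘ₗ
          (TensorProduct.lift (descendentMul act T)).lTensor H ∘ₗ
          (TensorProduct.assoc k H K K).toLinearMap =
        TensorProduct.lift (descendentMul act T) ∘ₗ
          TensorProduct.map (TensorProduct.lift act)
            (TensorProduct.lift act ∘ₗ (TensorProduct.lift (rightAction act T)).rTensor K) ∘ₗ
          (TensorProduct.assoc k (H ⊗[k] K) (H ⊗[k] K) K).toLinearMap ∘ₗ
          ((HopfOps.of k H).tensorComul (descendent act T)).rTensor K :=
      Point.linearMap_ext₃ fun x a b => by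
        simp only [LinearMap.comp_assoc, assoc_comp_pairing, lTensor_comp_pairing,
          rTensor_comp_pairing, map_comp_pairing, ← lin_descMul hT.moduleBialgebra,
          tensorComul_comp_pairing (HopfOps.of k H) (descendent act T) rfl rfl,
          ← lin_descAct hT.moduleBialgebra, ← hT.moduleBialgebra.lin_action,
          IsGroupRotaBaxter.apply_descMul]
    -- Freezing the argument `b` turns the ternary map of `e` into the map of the axiom.
    have e' (w : (H ⊗[k] K) ⊗[k] (H ⊗[k] K)) (b : K) :
        TensorProduct.map (TensorProduct.lift act)
            (TensorProduct.lift act ∘ₗ (TensorProduct.lift (rightAction act T)).rTensor K)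
            (TensorProduct.assoc k (H ⊗[k] K) (H ⊗[k] K) K (w ⊗ₜ b)) =
          TensorProduct.map (TensorProduct.lift act)
            (act.flip b ∘ₗ TensorProduct.lift (rightAction act T)) w := by
      induction w with
      | zero => simp
      | add u v hu hv => simp only [add_tmul, map_add, hu, hv]
      | tmul u v => simp
    exact fun x a b => congr($e ((x ⊗ₜ a) ⊗ₜ b)).trans
      (congrArg (TensorProduct.lift (descendentMul act T)) (e' _ b))
  act_one := hT.moduleBialgebra.act_one
  mul_ract := by
    have e : TensorProduct.lift (rightAction act T) ∘ₗ
          (LinearMap.mul' k H).rTensor K ∘ₗ (TensorProduct.assoc k H H K).symm.toLinearMap =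
        LinearMap.mul' k H ∘ₗ
          TensorProduct.map
            (TensorProduct.lift (rightAction act T) ∘ₗ (TensorProduct.lift act).lTensor H)
            (TensorProduct.lift (rightAction act T)) ∘ₗ
          (TensorProduct.assoc k H (H ⊗[k] K) (H ⊗[k] K)).symm.toLinearMap ∘ₗ
          ((HopfOps.of k H).tensorComul (descendent act T)).lTensor H :=
      Point.linearMap_ext₂ fun x r => by
        obtain ⟨y, a, rfl⟩ := Point.exists_eq_pair r
        simp only [Point.lin_pair, LinearMap.comp_assoc, assoc_symm_comp_pairing,
          lTensor_comp_pairing, rTensor_comp_pairing, map_comp_pairing, ← Point.lin_mul,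
          tensorComul_comp_pairing (HopfOps.of k H) (descendent act T) rfl rfl,
          ← lin_descAct hT.moduleBialgebra, ← hT.moduleBialgebra.lin_action,
          IsGroupRotaBaxter.mul_descAct]
    -- Likewise for a frozen argument `x`.
    have e' (x : H) (w : (H ⊗[k] K) ⊗[k] (H ⊗[k] K)) :
        TensorProduct.map
            (TensorProduct.lift (rightAction act T) ∘ₗ (TensorProduct.lift act).lTensor H)
            (TensorProduct.lift (rightAction act T))
            ((TensorProduct.assoc k H (H ⊗[k] K) (H ⊗[k] K)).symm (x ⊗ₜ w)) =
          TensorProduct.map (rightAction act T x ∘ₗ TensorProduct.lift act)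
            (TensorProduct.lift (rightAction act T)) w := by
      induction w with
      | zero => simp
      | add u v hu hv => simp only [tmul_add, map_add, hu, hv]
      | tmul u v => simp
    exact fun x y a => congr($e (x ⊗ₜ (y ⊗ₜ a))).trans
      (congrArg (LinearMap.mul' k H) (e' x _))
  one_ract := by
    have e : rightAction act T 1 = LinearMap.toSpanSingleton k H 1 ∘ₗ counit :=
      Point.linearMap_ext fun a => by
        have h := lin_descAct (T := T) hT.moduleBialgebra 1 a
        rw [Point.lin_one, pairing_unit_left, IsGroupRotaBaxter.one_descAct, Point.lin_one] at h
        rw [LinearMap.comp_assoc, Point.counit_comp_lin, h]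
        rfl
    exact fun a => congr($e a)
  compat := by
    have e : TensorProduct.map (TensorProduct.lift (rightAction act T)) (TensorProduct.lift act) ∘ₗ
          (HopfOps.of k H).tensorComul (descendent act T) =
        TensorProduct.map (TensorProduct.lift (rightAction act T)) (TensorProduct.lift act) ∘ₗ
          (TensorProduct.comm k _ _).toLinearMap ∘ₗ
          (HopfOps.of k H).tensorComul (descendent act T) :=
      Point.linearMap_ext₂ fun x a => by
        simp only [LinearMap.comp_assoc, comm_comp_pairing,
          tensorComul_comp_pairing (HopfOps.of k H) (descendent act T) rfl rfl]
    exact fun x a => congr($e (x ⊗ₜ a))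

end IsRelativeRotaBaxter

end Descendent

/-! ### The double crossproduct and the twist map -/

section Twist

variable {k : Type*} [Field k] {C H K : Type*} [AddCommGroup C] [Module k C] [Coalgebra k C]
  [IsCocomm k C] [Ring H] [HopfAlgebra k H] [Ring K] [HopfAlgebra k K]
  {act : H →ₗ[k] K →ₗ[k] K} {T : K →ₗc[k] H}

/-- On points, the twist map is `(a, x) ↦ (a, T(a) x)`. -/
theorem twistMap_comp_pairing (T : K →ₗc[k] H) (a : Point k C K) (x : Point k C H) :
    twistMap T ∘ₗ pairing a.lin x.lin = pairing a.lin (a.map T * x).lin := by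
  simp only [twistMap, LinearMap.comp_assoc, rTensor_comp_pairing, Point.comul_comp_lin,
    assoc_comp_pairing, lTensor_comp_pairing, Point.lin_mul, Point.lin_map]

variable [IsCocomm k H] [IsCocomm k K]

/-- On points, `(a, x) (b, y) = (a *_T (x ⇀ b), (x ↼ b) y)`. -/
theorem lift_doubleCrossproduct_mul
    (h : IsLeftModuleBialgebra (HopfOps.of k H) (HopfOps.of k K) act)
    (a b : Point k C K) (x y : Point k C H) :
    TensorProduct.lift (doubleCrossproduct (HopfOps.of k H) (descendent act T) act
        (rightAction act T)).mul ∘ₗ pairing (pairing a.lin x.lin) (pairing b.lin y.lin) =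
      pairing (descMul h.action (Point.map T) a (h.action x b)).lin
        (descAct h.action (Point.map T) x b * y).lin := by
  have hθ : (TensorProduct.map (TensorProduct.lift act)
        (TensorProduct.lift (rightAction act T)) ∘ₗ
        (HopfOps.of k H).tensorComul (descendent act T)) ∘ₗ pairing x.lin b.lin =
      pairing (h.action x b).lin (descAct h.action (Point.map T) x b).lin := by
    rw [LinearMap.comp_assoc,
      tensorComul_comp_pairing (HopfOps.of k H) (descendent act T) rfl rfl, map_comp_pairing,
      h.lin_action, lin_descAct]
  rw [lin_descMul, Point.lin_mul]
  exact exchangeMul_comp_pairing (descendentMul act T) (LinearMap.mul k H) _ a.lin b.lin _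
    x.lin y.lin _ hθ

/-- On points, `S(a, x) = (x⁻¹ ⇀ S_T(a), x⁻¹ ↼ S_T(a))`. -/
theorem doubleCrossproduct_antipode_comp
    (h : IsLeftModuleBialgebra (HopfOps.of k H) (HopfOps.of k K) act)
    (a : Point k C K) (x : Point k C H) :
    (doubleCrossproduct (HopfOps.of k H) (descendent act T) act (rightAction act T)).antipode ∘ₗ
        pairing a.lin x.lin =
      pairing (h.action x⁻¹ (descInv h.action (Point.map T) a)).lin
        (descAct h.action (Point.map T) x⁻¹ (descInv h.action (Point.map T) a)).lin := by
  have e₁ : (HopfOps.of k H).antipode = HopfAlgebra.antipode k := rfl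
  have e₂ : (descendent act T).antipode = descendentAntipode act T := rfl
  rw [doubleCrossproduct]
  simp only [e₁, e₂, LinearMap.comp_assoc, comm_comp_pairing, map_comp_pairing,
    tensorComul_comp_pairing (HopfOps.of k H) (descendent act T) rfl rfl,
    ← Point.lin_inv, ← lin_descInv h, ← lin_descAct h, ← h.lin_action]

/-- The inverse of `a ⊗ x ↦ a₁ ⊗ T(a₂) x` is `a ⊗ x ↦ a₁ ⊗ S(T(a₂)) x`. -/
theorem twistMap_bijective (T : K →ₗc[k] H) : Function.Bijective (twistMap T) := by
  have e₁ : twistMap ((antipodeCoalgHom k H).comp T) ∘ₗ twistMap T = LinearMap.id :=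
    Point.linearMap_ext₂ fun a x => by
      have : a.map ((antipodeCoalgHom k H).comp T) = (a.map T)⁻¹ := rfl
      rw [LinearMap.comp_assoc, twistMap_comp_pairing, twistMap_comp_pairing, this,
        inv_mul_cancel_left, LinearMap.id_comp]
  have e₂ : twistMap T ∘ₗ twistMap ((antipodeCoalgHom k H).comp T) = LinearMap.id :=
    Point.linearMap_ext₂ fun a x => by
      have : a.map ((antipodeCoalgHom k H).comp T) = (a.map T)⁻¹ := rfl
      rw [LinearMap.comp_assoc, twistMap_comp_pairing, twistMap_comp_pairing, this,
        mul_inv_cancel_left, LinearMap.id_comp]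
  exact Function.bijective_iff_has_inverse.mpr
    ⟨twistMap ((antipodeCoalgHom k H).comp T), fun u => congr($e₁ u), fun u => congr($e₂ u)⟩

/-- The twist map carries the double crossproduct to the smash product because, on points,
`T(x ⇀ b) (x ↼ b) = x T(b)`. -/
theorem IsRelativeRotaBaxter.isHopfIso_twistMap (hT : IsRelativeRotaBaxter act T) :
    (doubleCrossproduct (HopfOps.of k H) (descendent act T) act (rightAction act T)).IsHopfIso
      (smashProduct (HopfOps.of k H) (HopfOps.of k K) act) (twistMap T) where
  bijective := twistMap_bijective T
  map_mul := by
    have e : twistMap T ∘ₗ TensorProduct.lift (doubleCrossproduct (HopfOps.of k H)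
          (descendent act T) act (rightAction act T)).mul =
        TensorProduct.lift (smashProduct (HopfOps.of k H) (HopfOps.of k K) act).mul ∘ₗ
          TensorProduct.map (twistMap T) (twistMap T) :=
      Point.linearMap_ext₄ fun a x b y => by
        rw [LinearMap.comp_assoc, LinearMap.comp_assoc,
          lift_doubleCrossproduct_mul hT.moduleBialgebra, map_comp_pairing,
          twistMap_comp_pairing, twistMap_comp_pairing, twistMap_comp_pairing,
          lift_smashProduct_mul hT.moduleBialgebra, ← hT.isGroupRotaBaxter]
        have h₁ := IsGroupRotaBaxter.map_mul_descAct (φ := hT.moduleBialgebra.action)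
          (T := Point.map T) x b
        congr 2
        · rw [descMul, map_mul, MulAut.mul_apply]
        · rw [mul_assoc, ← mul_assoc _ _ y, h₁, mul_assoc, mul_assoc]
    exact fun u v => congr($e (u ⊗ₜ v))
  map_one := by
    simp [twistMap, doubleCrossproduct, smashProduct, descendent, HopfOps.of,
      Algebra.TensorProduct.one_def, hT.map_one]
  map_comul := by
    have e : TensorProduct.map (twistMap T) (twistMap T) ∘ₗ comul = comul ∘ₗ twistMap T :=
      Point.linearMap_ext₂ fun a x => by
        rw [LinearMap.comp_assoc, LinearMap.comp_assoc, twistMap_comp_pairing,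
          ← Point.lin_pair, ← Point.lin_pair, Point.comul_comp_lin, Point.comul_comp_lin,
          map_comp_pairing, Point.lin_pair, twistMap_comp_pairing, Point.lin_pair]
    exact fun u => congr($e u)
  map_counit := by
    have e : counit ∘ₗ twistMap T = (counit : K ⊗[k] H →ₗ[k] k) :=
      Point.linearMap_ext₂ fun a x => by
        rw [LinearMap.comp_assoc, twistMap_comp_pairing, Point.counit_comp_pairing,
          Point.counit_comp_pairing]
    have e' : (smashProduct (HopfOps.of k H) (HopfOps.of k K) act).counit =
        (counit : K ⊗[k] H →ₗ[k] k) := TensorProduct.ext' fun _ _ => mul_comm _ _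
    intro u
    refine (congr($e' (twistMap T u))).trans ((congr($e u)).trans ?_)
    exact congr($e' u).symm
  map_antipode := by
    have e : twistMap T ∘ₗ (doubleCrossproduct (HopfOps.of k H) (descendent act T) act
          (rightAction act T)).antipode =
        (smashProduct (HopfOps.of k H) (HopfOps.of k K) act).antipode ∘ₗ twistMap T :=
      Point.linearMap_ext₂ fun a x => by
        rw [LinearMap.comp_assoc, LinearMap.comp_assoc,
          doubleCrossproduct_antipode_comp hT.moduleBialgebra, twistMap_comp_pairing,
          twistMap_comp_pairing, smashProduct_antipode_comp hT.moduleBialgebra,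
          IsGroupRotaBaxter.map_mul_descAct, hT.isGroupRotaBaxter.map_descInv, mul_inv_rev,
          map_mul, MulAut.mul_apply, descInv]
    exact fun u => congr($e u)

end Twist

end RRB

end

open RRB in
theorem mainTheorem3 {k : Type*} [Field k] {H K : Type*}
    [Ring H] [HopfAlgebra k H] [Coalgebra.IsCocomm k H]
    [Ring K] [HopfAlgebra k K] [Coalgebra.IsCocomm k K]
    (act : H →ₗ[k] K →ₗ[k] K) (T : K →ₗc[k] H) (hT : IsRelativeRotaBaxter act T) :
    (descendent act T).IsHopfAlgebra ∧ (descendent act T).IsCocommutative ∧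
    IsRightModuleCoalgebra (HopfOps.of k H) (descendent act T) (rightAction act T) ∧
    IsMatchedPair (HopfOps.of k H) (descendent act T) act (rightAction act T) ∧
    (doubleCrossproduct (HopfOps.of k H) (descendent act T) act
      (rightAction act T)).IsHopfAlgebra ∧
    (smashProduct (HopfOps.of k H) (HopfOps.of k K) act).IsHopfAlgebra ∧
    (doubleCrossproduct (HopfOps.of k H) (descendent act T) act (rightAction act T)).IsHopfIso
      (smashProduct (HopfOps.of k H) (HopfOps.of k K) act) (twistMap T) :=
  have hsmash := isHopfAlgebra_smashProduct hT.moduleBialgebra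
  ⟨hT.isHopfAlgebra_descendent, Coalgebra.comm_comul k, hT.isRightModuleCoalgebra,
    hT.isMatchedPair, hT.isHopfIso_twistMap.isHopfAlgebra hsmash, hsmash, hT.isHopfIso_twistMap⟩
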